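/- Let $S$ be a countable set and let $\mu$ be a probability measure on $\{0,1\}^S$ with the product $\sigma$-algebra. For $\epsilon\in(0,1)$ let $\mu^{(+,\epsilon)}$ be the law of the configuration obtained by first choosing an element of $\{0,1\}^S$ according to $\mu$ and then independently changing each $0$ to a $1$ with probability $\epsilon$. The measure $\mu$ is called uniformly insertion tolerant if there is an $\epsilon>0$ such that for every $s\in S$, $\mu(\sigma(s)=1\mid\sigma(S\setminus\{s\}))\ge\epsilon$ almost surely. It is called uniformly upwards extractable if there are an $\epsilon\in(0,1)$ and a probability measure $\nu$ on $\{0,1\}^S$ such that $\mu=\nu^{(+,\epsilon)}$. **Theorem.** For every countably infinite set $S$ there exists a probability measure $\mu$ on $\{0,1\}^S$ that is uniformly insertion tolerant but not uniformly upwards extractable. Moreover, for $S=\mathbb{Z}$ such a measure $\mu$ on $\{0,1\}^{\mathbb{Z}}$ can be chosen to be translation invariant. -/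

import Mathlib

open MeasureTheory ProbabilityTheory

namespace SpinMeasure

/-- The space `{0,1}^S` of configurations on `S` (`true` is `1`, `false` is `0`), with the product
`σ`-algebra. -/
abbrev Config (S : Type*) : Type _ := S → Bool

/-- The product measure `π_p` on `{0,1}^S`: independently, each site is `1` with probability `p`
and `0` with probability `1 - p`. -/
noncomputable def bernoulliProduct (S : Type*) (p : unitInterval) : Measure (Config S) :=
  Measure.infinitePi fun _ : S => bernoulliMeasure true false p

/-- The configuration obtained from `x` by changing the `0`s of `x` at the sites marked by `z`
to `1`s, all other sites being left as they are. -/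
def switchOn {S : Type*} (x z : Config S) : Config S :=
  fun s => if x s = false ∧ z s = true then true else x s

/-- The measure `μ^{(+,ε)}`: the law of the configuration obtained by choosing `x` according to `μ`
and then independently changing each `0` of `x` to a `1` with probability `ε`. The marks telling
at which sites a `0` is to be changed have law `π_ε` and are independent of `x`. -/
noncomputable def upFlip {S : Type*} (μ : Measure (Config S)) (ε : unitInterval) :
    Measure (Config S) :=
  (μ.prod (bernoulliProduct S ε)).map fun w => switchOn w.1 w.2

/-- The `σ`-algebra on `{0,1}^S` generated by the coordinates at all sites other than `s`. -/
abbrev sigmaOff {S : Type*} (s : S) : MeasurableSpace (Config S) :=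
  MeasurableSpace.comap (fun (x : Config S) (t : {t : S // t ≠ s}) => x t) MeasurableSpace.pi

/-- `μ` is `ε`-insertion tolerant: for every site `s`, the conditional probability under `μ` of a
`1` at `s`, given the configuration off `s`, is almost surely at least `ε`. -/
def IsInsertionTolerant {S : Type*} (μ : Measure (Config S)) (ε : ℝ) : Prop :=
  ∀ s : S, ∀ᵐ x ∂μ, ε ≤ (μ⟦{y : Config S | y s = true} | sigmaOff s⟧) x

/-- `μ` is uniformly insertion tolerant. -/
def IsUniformlyInsertionTolerant {S : Type*} (μ : Measure (Config S)) : Prop :=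
  ∃ ε : ℝ, 0 < ε ∧ IsInsertionTolerant μ ε

/-- `μ` is `ε`-upwards extractable: `μ = ν^{(+,ε)}` for some probability measure `ν`. -/
def IsUpwardsExtractable {S : Type*} (μ : Measure (Config S)) (ε : unitInterval) : Prop :=
  ∃ ν : Measure (Config S), IsProbabilityMeasure ν ∧ μ = upFlip ν ε

/-- `μ` is uniformly upwards extractable: it is `ε`-upwards extractable for some `ε ∈ (0,1)`. -/
def IsUniformlyUpwardsExtractable {S : Type*} (μ : Measure (Config S)) : Prop :=
  ∃ ε : unitInterval, 0 < ε ∧ ε < 1 ∧ IsUpwardsExtractable μ ε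

/-- The measure `μ` on `{0,1}^ℤ` is invariant under all translations of `ℤ`. -/
def IsTranslationInvariant (μ : Measure (Config ℤ)) : Prop :=
  ∀ n : ℤ, μ.map (fun (x : Config ℤ) (k : ℤ) => x (k + n)) = μ

end SpinMeasure

/-! If `μ = ν^{(+,ε)}`, then for finite `B` the `μ`-mean of `∏ s ∈ B, (x s - ε)` is `(1-ε)^|B| · ν(x
= 1 on B) ≥ 0`: a site with `x s = 0` averages to `0` after the random switching. It therefore
suffices to make this mean negative for some `B`, for each `ε`
(`IsUpwardsExtractable.integral_prod_testFactor_nonneg`).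

On a block of `n` fair bits, tilt the density by `1 - (1/2)∏ ±1`. A flip changes a weight by a
factor of at most `3`, which gives insertion tolerance `1/4`, while proper subsets of the block
still look fair. The test mean on a full block is `((1-2ε)/2)^n - (1/2)(1/2)^n`, negative for large
`n` as `|1-2ε| < 1`.

To treat all `ε` at once and be translation invariant, mix i.i.d. block laws over the sizes `n =
2^(k+1)` and all offsets. The blocks are progressions of `n` terms with step `n`, so that the test
block `{0, n, ..., (n-1)n}` contains no full block of another size (`eq_of_block_subset_multiples`).
Every component then contributes at most the fair value, and one of weight `n⁻³` contributes the
negative correction, which wins because `n³(1-2ε)^n → 0` (`hasNegativeTests_blockMixture`). Other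
countably infinite `S` follow by a bijection with `ℤ`. -/

namespace SpinMeasure

open scoped ENNReal

/-- The change of the value of a configuration at the site `s`. -/
def flipAt {S : Type*} [DecidableEq S] (s : S) (x : S → Bool) : S → Bool :=
  Function.update x s (!x s)

lemma measurable_flipAt {S : Type*} [DecidableEq S] (s : S) :
    Measurable (flipAt s : (S → Bool) → S → Bool) := by
  refine measurable_pi_lambda _ fun t => ?_
  by_cases h : t = s
  · subst h
    simpa [flipAt, Function.comp_def] using
      (measurable_of_finite (fun b : Bool => !b)).comp (measurable_pi_apply t)
  · simpa [flipAt, h] using measurable_pi_apply t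

lemma flipAt_flipAt {S : Type*} [DecidableEq S] (s : S) (x : S → Bool) :
    flipAt s (flipAt s x) = x := by
  simp [flipAt]

/-! ### The parity-tilted law on a finite block -/

/-- The factor `1` at `true` and `-1` at `false`. -/
def sgn (b : Bool) : ℝ := if b then 1 else -1

lemma abs_prod_sgn {K : Type*} [Fintype K] (z : K → Bool) : |∏ k, sgn (z k)| = 1 := by
  rw [Finset.abs_prod]
  exact Finset.prod_eq_one fun k _ => by cases z k <;> simp [sgn]

/-- The weights of a law on `{0,1}^K` that favours an odd number of `0`s. -/
noncomputable def parityWeight (K : Type*) [Fintype K] (z : K → Bool) : ℝ :=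
  (1 / 2) ^ Fintype.card K * (1 - 1 / 2 * ∏ k, sgn (z k))

lemma parityWeight_nonneg {K : Type*} [Fintype K] (z : K → Bool) : 0 ≤ parityWeight K z := by
  have h := abs_le.1 (abs_prod_sgn z).le
  unfold parityWeight
  have : 0 ≤ 1 - 1 / 2 * ∏ k, sgn (z k) := by linarith
  positivity

/-- All weights lie between `1/2` and `3/2` times the uniform weight, whence the ratio `3`. -/
lemma parityWeight_flipAt_le {K : Type*} [Fintype K] [DecidableEq K] (k : K) (z : K → Bool) :
    parityWeight K (flipAt k z) ≤ 3 * parityWeight K z := by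
  have h := abs_le.1 (abs_prod_sgn z).le
  have h' := abs_le.1 (abs_prod_sgn (flipAt k z)).le
  unfold parityWeight
  rw [mul_left_comm]
  gcongr
  linarith

/-- Both terms of the weight factor over coordinates. The second product vanishes as soon as one `g
k` is constant, so the tilt is invisible on proper subsets of the block. -/
lemma sum_prod_parityWeight {K : Type*} [Fintype K] [DecidableEq K] (g : K → Bool → ℝ) :
    ∑ z, parityWeight K z * ∏ k, g k (z k) =
      ∏ k, ((g k true + g k false) / 2) - 1 / 2 * ∏ k, ((g k true - g k false) / 2) := by
  have key (h : K → Bool → ℝ) : ∑ z : K → Bool, ∏ k, h k (z k) =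
      ∏ k, (h k true + h k false) := by
    have := Finset.prod_univ_sum (fun _ : K => (Finset.univ : Finset Bool)) h
    rw [Fintype.piFinset_univ] at this
    rw [← this]
    exact Finset.prod_congr rfl fun k _ => by simp
  have h1 := key g
  have h2 := key fun k b => sgn b * g k b
  simp only [sgn, if_true, Bool.false_eq_true, if_false] at h2
  simp only [div_eq_mul_inv, Finset.prod_mul_distrib, Finset.prod_const, Finset.card_univ]
  rw [← h1]
  have h3 : ∏ k, (g k true - g k false) = ∑ z : K → Bool, (∏ k, sgn (z k)) * ∏ k, g k (z k) := by
    rw [← Finset.prod_congr rfl fun k _ => show 1 * g k true + -1 * g k false = _ by ring, ← h2]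
    simp only [← Finset.prod_mul_distrib, sgn]
  rw [h3, Finset.sum_mul, Finset.sum_mul, Finset.mul_sum, ← Finset.sum_sub_distrib]
  refine Finset.sum_congr rfl fun z _ => ?_
  simp only [parityWeight, one_div]
  ring

/-- The law on `{0,1}^K` with weights `parityWeight K`. -/
noncomputable def parityLaw (K : Type*) [Fintype K] [DecidableEq K] : Measure (K → Bool) :=
  ∑ z, ENNReal.ofReal (parityWeight K z) • Measure.dirac z

lemma parityLaw_apply {K : Type*} [Fintype K] [DecidableEq K] (A : Set (K → Bool)) :
    parityLaw K A = ∑ z, ENNReal.ofReal (parityWeight K z) * A.indicator 1 z := by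
  simp [parityLaw]

instance {K : Type*} [Fintype K] [DecidableEq K] [Nonempty K] :
    IsProbabilityMeasure (parityLaw K) where
  measure_univ := by
    have h := sum_prod_parityWeight (K := K) fun _ _ => 1
    simp at h
    simp [parityLaw_apply, ← ENNReal.ofReal_sum_of_nonneg fun z _ => parityWeight_nonneg z, h]

lemma integral_parityLaw {K : Type*} [Fintype K] [DecidableEq K] (h : (K → Bool) → ℝ) :
    ∫ z, h z ∂parityLaw K = ∑ z, parityWeight K z * h z := by
  rw [parityLaw, integral_finsetSum_measure]
  · refine Finset.sum_congr rfl fun z _ => ?_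
    rw [integral_smul_measure, integral_dirac, ENNReal.toReal_ofReal (parityWeight_nonneg z),
      smul_eq_mul]
  · intro z _
    exact (integrable_dirac (by simp)).smul_measure ENNReal.ofReal_ne_top

lemma parityLaw_preimage_flipAt_le {K : Type*} [Fintype K] [DecidableEq K] (k : K)
    (A : Set (K → Bool)) : parityLaw K (flipAt k ⁻¹' A) ≤ 3 * parityLaw K A := by
  let σ : Equiv.Perm (K → Bool) := ⟨flipAt k, flipAt k, flipAt_flipAt k, flipAt_flipAt k⟩
  rw [parityLaw_apply, parityLaw_apply, Finset.mul_sum, ← Equiv.sum_comp σ]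
  refine Finset.sum_le_sum fun z _ => ?_
  have h1 : (flipAt k ⁻¹' A).indicator (1 : (K → Bool) → ℝ≥0∞) (σ z) = A.indicator 1 z := by
    change A.indicator 1 (flipAt k (flipAt k z)) = _
    rw [flipAt_flipAt]
  rw [h1, ← mul_assoc]
  gcongr
  calc ENNReal.ofReal (parityWeight K (σ z)) ≤ ENNReal.ofReal (3 * parityWeight K z) :=
        ENNReal.ofReal_le_ofReal (parityWeight_flipAt_le k z)
    _ = 3 * ENNReal.ofReal (parityWeight K z) := by
        rw [ENNReal.ofReal_mul (by norm_num)]; simp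

/-! ### Infinite products: changing one coordinate, and means of products -/

lemma measurable_update_prod {ι X : Type*} [DecidableEq ι] [MeasurableSpace X] (i : ι) :
    Measurable fun w : X × (ι → X) => Function.update w.2 i w.1 := by
  refine measurable_pi_lambda _ fun t => ?_
  by_cases h : t = i
  · subst h; simpa using measurable_fst
  · simpa [h, Function.comp_def] using (measurable_pi_apply t).comp measurable_snd

/-- Resampling one coordinate does not change a product measure. -/
lemma map_update_infinitePi {ι X : Type*} [DecidableEq ι] [MeasurableSpace X] (ρ : Measure X)
    [IsProbabilityMeasure ρ] (i : ι) :
    (ρ.prod (Measure.infinitePi fun _ : ι => ρ)).map (fun w => Function.update w.2 i w.1) =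
      Measure.infinitePi fun _ : ι => ρ := by
  have hm := measurable_update_prod (X := X) i
  refine Measure.eq_infinitePi _ fun s t ht => ?_
  rw [Measure.map_apply hm (MeasurableSet.pi s.countable_toSet fun j _ => ht j)]
  by_cases hi : i ∈ s
  · have : (fun w : X × (ι → X) => Function.update w.2 i w.1) ⁻¹' (s : Set ι).pi t =
        t i ×ˢ ((s.erase i : Finset ι) : Set ι).pi t := by
      ext w
      simp only [Set.mem_preimage, Set.mem_pi, Finset.mem_coe, Set.mem_prod, Finset.mem_erase]
      constructor
      · intro h
        exact ⟨by simpa using h i hi, fun j hj => by simpa [hj.1] using h j hj.2⟩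
      · rintro ⟨h1, h2⟩ j hj
        by_cases hji : j = i
        · subst hji; simpa using h1
        · simpa [hji] using h2 j ⟨hji, hj⟩
    rw [this, Measure.prod_prod, Measure.infinitePi_pi _ fun j _ => ht j,
      Finset.mul_prod_erase s (fun j => ρ (t j)) hi]
  · have : (fun w : X × (ι → X) => Function.update w.2 i w.1) ⁻¹' (s : Set ι).pi t =
        Set.univ ×ˢ (s : Set ι).pi t := by
      ext w
      simp only [Set.mem_preimage, Set.mem_pi, Finset.mem_coe, Set.mem_prod, Set.mem_univ,
        true_and]
      refine forall₂_congr fun j hj => ?_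
      rw [Function.update_of_ne (by rintro rfl; exact hi hj)]
    rw [this, Measure.prod_prod, Measure.infinitePi_pi _ fun j _ => ht j, measure_univ, one_mul]

/-- Resampling coordinate `i` writes the measure as `ρ.prod P`; by Fubini the bound for `ρ` applies
on each slice. -/
lemma infinitePi_preimage_update_le {ι X : Type*} [DecidableEq ι] [MeasurableSpace X]
    (ρ : Measure X) [IsProbabilityMeasure ρ] (i : ι) (φ : X → X) (hφ : Measurable φ)
    (C : ℝ≥0∞) (h : ∀ A, MeasurableSet A → ρ (φ ⁻¹' A) ≤ C * ρ A)
    {A : Set (ι → X)} (hA : MeasurableSet A) :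
    Measure.infinitePi (fun _ : ι => ρ) ((fun y => Function.update y i (φ (y i))) ⁻¹' A) ≤
      C * Measure.infinitePi (fun _ : ι => ρ) A := by
  have hm := measurable_update_prod (X := X) i
  have hu : Measurable fun y : ι → X => Function.update y i (φ (y i)) :=
    hm.comp ((hφ.comp (measurable_pi_apply i)).prodMk measurable_id)
  have h1 := map_update_infinitePi ρ i
  set P := Measure.infinitePi fun _ : ι => ρ
  rw [← h1, Measure.map_apply hm (hu hA), Measure.map_apply hm hA,
    Measure.prod_apply_symm (hm (hu hA)), Measure.prod_apply_symm (hm hA),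
    ← lintegral_const_mul _ (measurable_measure_prodMk_right (hm hA))]
  refine lintegral_mono fun y => ?_
  have := h ((fun x => (x, y)) ⁻¹' ((fun w : X × (ι → X) => Function.update w.2 i w.1) ⁻¹' A))
    (measurable_prodMk_right (hm hA))
  refine le_trans (le_of_eq ?_) this
  congr 1
  ext x
  simp

lemma integral_prod_infinitePi {ι X : Type*} [MeasurableSpace X] (ρ : Measure X)
    [IsProbabilityMeasure ρ] (J : Finset ι) (g : ι → X → ℝ) (hg : ∀ i, Measurable (g i)) :
    ∫ y, ∏ i ∈ J, g i (y i) ∂Measure.infinitePi (fun _ : ι => ρ) = ∏ i ∈ J, ∫ x, g i x ∂ρ := by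
  have hind : iIndepFun (fun (i : J) (y : ι → X) => g i (y i))
      (Measure.infinitePi fun _ : ι => ρ) :=
    (iIndepFun_infinitePi (P := fun _ : ι => ρ) (X := g) hg).precomp Subtype.val_injective
  have h := hind.integral_fun_prod_eq_prod_integral fun i =>
    ((hg i).comp (measurable_pi_apply _)).aestronglyMeasurable
  rw [← Finset.prod_coe_sort J fun i => ∫ x, g i x ∂ρ]
  simp_rw [← Finset.prod_coe_sort J]
  rw [h]
  refine Finset.prod_congr rfl fun i _ => ?_
  have hmap := Measure.infinitePi_map_eval (μ := fun _ : ι => ρ) i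
  conv_rhs => rw [← hmap]
  rw [integral_map (measurable_pi_apply _).aemeasurable (hg _).aestronglyMeasurable]

/-! ### Bounded flips and insertion tolerance -/

/-- Changing the value at one site multiplies probabilities by at most `3`. -/
def FlipBounded {S : Type*} [DecidableEq S] (μ : Measure (Config S)) : Prop :=
  ∀ (s : S) (A : Set (Config S)), MeasurableSet A → μ (flipAt s ⁻¹' A) ≤ 3 * μ A

lemma sigmaOff_le {S : Type*} (s : S) : sigmaOff s ≤ MeasurableSpace.pi :=
  Measurable.comap_le (measurable_pi_lambda _ fun _ => measurable_pi_apply _)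

lemma flipAt_preimage_of_measurableSet_sigmaOff {S : Type*} [DecidableEq S] {s : S}
    {A : Set (Config S)} (hA : MeasurableSet[sigmaOff s] A) : flipAt s ⁻¹' A = A := by
  obtain ⟨B, -, rfl⟩ := hA
  ext x
  have : (fun t : {t : S // t ≠ s} => flipAt s x t) = fun t : {t : S // t ≠ s} => x t := by
    funext t
    simp [flipAt, t.2]
  simp only [Set.mem_preimage, this]

/-- A set `A` in `sigmaOff s` is invariant under the flip at `s`, which swaps its parts with `0` and
`1` at `s`. Hence `μ A ≤ (3 + 1) μ (A ∩ {y | y s = true})`, and integrating over all such `A` gives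
the conditional bound `1/4`. -/
lemma FlipBounded.isUniformlyInsertionTolerant {S : Type*} [DecidableEq S]
    {μ : Measure (Config S)} [IsProbabilityMeasure μ] (h : FlipBounded μ) :
    IsUniformlyInsertionTolerant μ := by
  refine ⟨1 / 4, by norm_num, fun s => ?_⟩
  have hm := sigmaOff_le s
  have hO : MeasurableSet {y : Config S | y s = true} :=
    (measurable_pi_apply (X := fun _ : S => Bool) s) (measurableSet_singleton true)
  have hint : Integrable ({y : Config S | y s = true}.indicator fun _ => (1 : ℝ)) μ :=
    (integrable_const 1).indicator hO
  refine ae_le_of_ae_le_trim (hm := hm) (f₁ := fun _ => (1 / 4 : ℝ)) ?_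
  refine ae_le_of_forall_setIntegral_le (integrable_const _)
    (integrable_condExp.trim hm stronglyMeasurable_condExp) fun A hA _ => ?_
  rw [← setIntegral_trim hm stronglyMeasurable_const hA,
    ← setIntegral_trim hm stronglyMeasurable_condExp hA, setIntegral_condExp hm hint hA,
    setIntegral_indicator hO, setIntegral_const, setIntegral_const]
  have hA' := hm _ hA
  have h0 : μ (A ∩ {y | y s = true}ᶜ) ≤ 3 * μ (A ∩ {y | y s = true}) := by
    refine le_trans (measure_mono fun x hx => ?_) (h s _ (hA'.inter hO))
    rw [Set.preimage_inter, flipAt_preimage_of_measurableSet_sigmaOff hA]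
    refine ⟨hx.1, ?_⟩
    simpa [flipAt] using hx.2
  have h1 : μ.real (A ∩ {y | y s = true}ᶜ) ≤ 3 * μ.real (A ∩ {y | y s = true}) := by
    have := ENNReal.toReal_mono (by finiteness) h0
    simpa [measureReal_def] using this
  have h2 := measureReal_inter_add_sdiff (μ := μ) (s := A) hO
  rw [Set.sdiff_eq] at h2
  simp only [smul_eq_mul]
  linarith

/-! ### Test products as an obstruction to extractability -/

/-- The test factor: `1 - ε` at `1` and `-ε` at `0`. -/
def testFactor (ε : ℝ) (b : Bool) : ℝ := if b then 1 - ε else -ε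

lemma integral_switchOn_prod_testFactor {S : Type*} (ε : unitInterval) (x : Config S)
    (B : Finset S) :
    ∫ z, ∏ s ∈ B, testFactor ε (switchOn x z s) ∂bernoulliProduct S ε =
      ∏ s ∈ B, if x s then 1 - (ε : ℝ) else 0 := by
  have h := integral_prod_infinitePi (bernoulliMeasure true false ε) B
    (fun s b => testFactor ε (if x s = false ∧ b = true then true else x s))
    fun s => measurable_of_finite _
  unfold bernoulliProduct switchOn
  rw [h]
  refine Finset.prod_congr rfl fun s _ => ?_
  rw [integral_bernoulliMeasure]
  cases x s <;> simp [testFactor] <;> ring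

lemma measurable_prod_testFactor {S : Type*} (ε : ℝ) (B : Finset S) :
    Measurable fun x : Config S => ∏ s ∈ B, testFactor ε (x s) :=
  Finset.measurable_prod _ fun s _ =>
    (measurable_of_finite (testFactor ε)).comp (measurable_pi_apply s)

lemma abs_prod_testFactor_le {S : Type*} {ε : ℝ} (h0 : 0 ≤ ε) (h1 : ε ≤ 1) (B : Finset S)
    (x : Config S) : |∏ s ∈ B, testFactor ε (x s)| ≤ 1 := by
  rw [Finset.abs_prod]
  refine Finset.prod_le_one (fun _ _ => abs_nonneg _) fun s _ => ?_
  cases x s <;> simp [testFactor, abs_le] <;> constructor <;> linarith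

lemma integrable_prod_testFactor {S : Type*} {ε : ℝ} (h0 : 0 ≤ ε) (h1 : ε ≤ 1) (B : Finset S)
    (μ : Measure (Config S)) [IsFiniteMeasure μ] :
    Integrable (fun x : Config S => ∏ s ∈ B, testFactor ε (x s)) μ :=
  Integrable.of_bound (measurable_prod_testFactor ε B).aestronglyMeasurable 1
    (Filter.Eventually.of_forall fun x => abs_prod_testFactor_le h0 h1 B x)

lemma measurable_switchOn {S : Type*} :
    Measurable fun w : Config S × Config S => switchOn w.1 w.2 := by
  refine measurable_pi_lambda _ fun s => ?_
  exact (measurable_of_finite fun b : Bool × Bool =>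
    if b.1 = false ∧ b.2 = true then true else b.1).comp
    (((measurable_pi_apply (X := fun _ : S => Bool) s).comp measurable_fst).prodMk
      ((measurable_pi_apply (X := fun _ : S => Bool) s).comp measurable_snd))

instance {S : Type*} (p : unitInterval) : IsProbabilityMeasure (bernoulliProduct S p) := by
  unfold bernoulliProduct; infer_instance

lemma IsUpwardsExtractable.integral_prod_testFactor_nonneg {S : Type*} {μ : Measure (Config S)}
    {ε : unitInterval} (h : IsUpwardsExtractable μ ε) (B : Finset S) :
    0 ≤ ∫ x, ∏ s ∈ B, testFactor ε (x s) ∂μ := by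
  obtain ⟨ν, hν, rfl⟩ := h
  have hint := integrable_prod_testFactor ε.2.1 ε.2.2 B
    ((ν.prod (bernoulliProduct S ε)).map fun w => switchOn w.1 w.2)
  rw [upFlip, integral_map measurable_switchOn.aemeasurable hint.aestronglyMeasurable,
    integral_prod (fun w => ∏ s ∈ B, testFactor ε (switchOn w.1 w.2 s))
      (hint.comp_measurable measurable_switchOn)]
  refine integral_nonneg fun x => ?_
  simp only [Pi.zero_apply]
  rw [integral_switchOn_prod_testFactor]
  refine Finset.prod_nonneg fun s _ => ?_
  have := ε.2.2
  split_ifs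
  · linarith
  · exact le_rfl

/-- For each `ε ∈ (0,1)` some product of test factors has a negative mean. -/
def HasNegativeTests {S : Type*} (μ : Measure (Config S)) : Prop :=
  ∀ ε : ℝ, 0 < ε → ε < 1 → ∃ B : Finset S, ∫ x, ∏ s ∈ B, testFactor ε (x s) ∂μ < 0

lemma HasNegativeTests.not_isUniformlyUpwardsExtractable {S : Type*} {μ : Measure (Config S)}
    (h : HasNegativeTests μ) : ¬ IsUniformlyUpwardsExtractable μ := by
  rintro ⟨ε, h0, h1, hε⟩
  obtain ⟨B, hB⟩ := h ε h0 h1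
  exact absurd (hε.integral_prod_testFactor_nonneg B) (not_le.2 hB)

/-! ### Transport along bijections of the site set -/

lemma measurable_comp_config {S T : Type*} (e : T → S) :
    Measurable fun (x : Config S) (t : T) => x (e t) :=
  measurable_pi_lambda _ fun _ => measurable_pi_apply _

lemma FlipBounded.map_equiv {S T : Type*} [DecidableEq S] [DecidableEq T]
    {μ : Measure (Config S)} (h : FlipBounded μ) (e : T ≃ S) :
    FlipBounded (μ.map fun (x : Config S) (t : T) => x (e t)) := by
  intro t A hA
  rw [Measure.map_apply (measurable_comp_config e) (measurable_flipAt t hA),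
    Measure.map_apply (measurable_comp_config e) hA]
  refine le_trans (le_of_eq ?_) (h (e t) _ (measurable_comp_config e hA))
  congr 1
  ext x
  have : flipAt t (fun t => x (e t)) = fun t' => flipAt (e t) x (e t') := by
    funext t'
    by_cases ht : t' = t
    · subst ht; simp [flipAt]
    · simp [flipAt, ht]
  simp only [Set.mem_preimage, this]

lemma HasNegativeTests.map_equiv {S T : Type*} {μ : Measure (Config S)}
    (h : HasNegativeTests μ) (e : T ≃ S) :
    HasNegativeTests (μ.map fun (x : Config S) (t : T) => x (e t)) := by
  intro ε h0 h1
  obtain ⟨B, hB⟩ := h ε h0 h1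
  refine ⟨B.map e.symm.toEmbedding, ?_⟩
  rw [integral_map (measurable_comp_config e).aemeasurable
    (measurable_prod_testFactor ε _).aestronglyMeasurable]
  simpa using hB

/-! ### Independent parity blocks -/

/-- The configuration on `S` made of configurations on `K`, one for each `i : ι`. -/
def assemble {S ι K : Type*} (e : S ≃ ι × K) (y : ι → K → Bool) : Config S :=
  fun s => y (e s).1 (e s).2

lemma measurable_assemble {S ι K : Type*} (e : S ≃ ι × K) : Measurable (assemble e) :=
  measurable_pi_lambda _ fun s => (measurable_pi_apply (e s).2).comp (measurable_pi_apply (e s).1)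

/-- The law of a configuration on `S` whose restrictions to the blocks `{e.symm (i, k) | k : K}`
are independent with law `parityLaw K`. -/
noncomputable def blockLaw {S ι K : Type*} [Fintype K] [DecidableEq K] (e : S ≃ ι × K) :
    Measure (Config S) :=
  (Measure.infinitePi fun _ : ι => parityLaw K).map (assemble e)

section

variable {S ι K : Type*} [Fintype K]

instance [DecidableEq K] [Nonempty K] (e : S ≃ ι × K) : IsProbabilityMeasure (blockLaw e) :=
  Measure.isProbabilityMeasure_map (measurable_assemble e).aemeasurable

lemma flipBounded_blockLaw [DecidableEq K] [Nonempty K] [DecidableEq S] [DecidableEq ι]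
    (e : S ≃ ι × K) : FlipBounded (blockLaw e) := by
  intro s A hA
  rw [blockLaw, Measure.map_apply (measurable_assemble e) (measurable_flipAt s hA),
    Measure.map_apply (measurable_assemble e) hA]
  refine le_trans (le_of_eq ?_) (infinitePi_preimage_update_le (parityLaw K) (e s).1
    (flipAt (e s).2) (measurable_flipAt _) 3 (fun B _ => parityLaw_preimage_flipAt_le _ B)
    (measurable_assemble e hA))
  congr 1
  ext y
  have : flipAt s (assemble e y) =
      assemble e (Function.update y (e s).1 (flipAt (e s).2 (y (e s).1))) := by
    funext t
    by_cases ht : t = s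
    · subst ht; simp [flipAt, assemble]
    · by_cases h1 : (e t).1 = (e s).1
      · have h2 : (e t).2 ≠ (e s).2 := fun h2 => ht (e.injective (Prod.ext h1 h2))
        simp [flipAt, assemble, ht, h1, h2]
      · simp [flipAt, assemble, ht, h1]
  simp only [Set.mem_preimage, this]

lemma map_blockLaw_comp [DecidableEq K] {T : Type*} (e : S ≃ ι × K) (f : T ≃ S) :
    (blockLaw e).map (fun (x : Config S) (t : T) => x (f t)) = blockLaw (f.trans e) := by
  rw [blockLaw, blockLaw, Measure.map_map (measurable_comp_config f) (measurable_assemble e)]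
  rfl

lemma blockLaw_trans_prodCongr [DecidableEq K] [Nonempty K] (e : S ≃ ι × K)
    (τ : Equiv.Perm ι) :
    blockLaw (e.trans (τ.prodCongr (Equiv.refl K))) = blockLaw e := by
  have h : (Measure.infinitePi fun _ : ι => parityLaw K).map (fun y i => y (τ i)) =
      Measure.infinitePi fun _ : ι => parityLaw K :=
    Measure.map_infinitePi_infinitePi_of_inj (P := fun _ : ι => parityLaw K) τ.injective
  conv_rhs => rw [blockLaw, ← h]
  rw [blockLaw, Measure.map_map (measurable_assemble e)
    (measurable_pi_lambda _ fun i => measurable_pi_apply _)]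
  rfl

lemma prod_eq_prod_blocks [DecidableEq S] [DecidableEq ι] (e : S ≃ ι × K) (B : Finset S)
    (g : ι × K → ℝ) :
    ∏ s ∈ B, g (e s) = ∏ i ∈ B.image (fun s => (e s).1), ∏ k,
      if e.symm (i, k) ∈ B then g (i, k) else 1 := by
  rw [← Finset.prod_product', Finset.prod_ite, Finset.prod_const_one, mul_one]
  refine Finset.prod_bij (fun s _ => e s) ?_ (fun _ _ _ _ h => e.injective h) ?_ fun _ _ => rfl
  · intro s hs
    simp only [Finset.mem_filter, Finset.mem_product, Finset.mem_image, Finset.mem_univ, and_true]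
    exact ⟨⟨s, hs, rfl⟩, by simpa using hs⟩
  · intro p hp
    exact ⟨e.symm p, (Finset.mem_filter.1 hp).2, by simp⟩

/-- Under a block law the values on a set containing no full block are independent and uniform. -/
lemma integral_blockLaw_of_forall_notMem [DecidableEq K] [Nonempty K] [DecidableEq S]
    [DecidableEq ι] (e : S ≃ ι × K) (B : Finset S) (f : Bool → ℝ)
    (h : ∀ i, ∃ k, e.symm (i, k) ∉ B) :
    ∫ x, ∏ s ∈ B, f (x s) ∂blockLaw e = ((f true + f false) / 2) ^ B.card := by
  have hf : Measurable fun x : Config S => ∏ s ∈ B, f (x s) :=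
    Finset.measurable_prod _ fun s _ => (measurable_of_finite f).comp (measurable_pi_apply s)
  rw [blockLaw, integral_map (measurable_assemble e).aemeasurable hf.aestronglyMeasurable]
  have h1 (y : ι → K → Bool) : ∏ s ∈ B, f (assemble e y s) =
      ∏ i ∈ B.image (fun s => (e s).1), ∏ k, if e.symm (i, k) ∈ B then f (y i k) else 1 :=
    prod_eq_prod_blocks e B fun p => f (y p.1 p.2)
  simp_rw [h1]
  rw [integral_prod_infinitePi (parityLaw K) _
    (fun i z => ∏ k, if e.symm (i, k) ∈ B then f (z k) else 1) fun i => measurable_of_finite _]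
  rw [← Finset.prod_const, prod_eq_prod_blocks e B fun _ => (f true + f false) / 2]
  refine Finset.prod_congr rfl fun i _ => ?_
  rw [integral_parityLaw, sum_prod_parityWeight fun k b => if e.symm (i, k) ∈ B then f b else 1]
  -- A site of block `i` outside `B` carries a constant factor, which kills the tilt term.
  obtain ⟨k, hk⟩ := h i
  rw [Finset.prod_eq_zero (f := fun k => ((if e.symm (i, k) ∈ B then f true else 1) -
    if e.symm (i, k) ∈ B then f false else 1) / 2) (Finset.mem_univ k) (by simp [hk]), mul_zero,
    sub_zero]
  refine Finset.prod_congr rfl fun k _ => ?_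
  split_ifs <;> norm_num

lemma integral_blockLaw_block [DecidableEq K] [Nonempty K] [DecidableEq S] (e : S ≃ ι × K)
    (i : ι) (f : Bool → ℝ) :
    ∫ x, ∏ s ∈ Finset.univ.image (fun k => e.symm (i, k)), f (x s) ∂blockLaw e =
      ((f true + f false) / 2) ^ Fintype.card K -
        1 / 2 * ((f true - f false) / 2) ^ Fintype.card K := by
  have hf : Measurable fun x : Config S =>
      ∏ s ∈ Finset.univ.image (fun k => e.symm (i, k)), f (x s) :=
    Finset.measurable_prod _ fun s _ => (measurable_of_finite f).comp (measurable_pi_apply s)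
  rw [blockLaw, integral_map (measurable_assemble e).aemeasurable hf.aestronglyMeasurable]
  have hinj : Function.Injective fun k => e.symm (i, k) := fun k k' h => by simpa using h
  simp_rw [Finset.prod_image hinj.injOn, assemble, Equiv.apply_symm_apply]
  have h := integral_prod_infinitePi (parityLaw K) {i} (fun _ z => ∏ k, f (z k))
    fun _ => measurable_of_finite _
  simp only [Finset.prod_singleton] at h
  rw [h, integral_parityLaw, sum_prod_parityWeight fun _ => f]
  simp only [Finset.prod_const, Finset.card_univ]

end

/-! ### Spaced blocks in `ℤ` -/

/-- The partition of `ℤ` into the blocks `{(q * n + i) * n + r - j | i < n}`, where `q : ℤ` and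
`r < n`. -/
def spacedBlocks (n : ℕ) [NeZero n] (j : ℤ) : ℤ ≃ (ℤ × Fin n) × Fin n :=
  (Equiv.addRight j).trans <| (Int.divModEquiv n).trans <|
    ((Int.divModEquiv n).prodCongr (Equiv.refl (Fin n))).trans
      ⟨fun p => ((p.1.1, p.2), p.1.2), fun p => ((p.1.1, p.2), p.1.2), fun _ => rfl, fun _ => rfl⟩

lemma spacedBlocks_symm_apply (n : ℕ) [NeZero n] (j : ℤ) (q : ℤ) (r i : Fin n) :
    (spacedBlocks n j).symm ((q, r), i) = (q * n + i) * n + r - j := rfl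

/-- A shift by `n ^ 2` only renumbers the blocks, `q` becoming `q + 1`, so there are only `n ^ 2`
offsets to average over. -/
lemma spacedBlocks_add_sq (n : ℕ) [NeZero n] (j : ℤ) :
    spacedBlocks n (j + n ^ 2) =
      (spacedBlocks n j).trans
        (((Equiv.addRight (1 : ℤ)).prodCongr (Equiv.refl (Fin n))).prodCongr
          (Equiv.refl (Fin n))) := by
  rw [← Equiv.symm_bijective.injective.eq_iff]
  ext ⟨⟨q, r⟩, i⟩
  change _ = (spacedBlocks n j).symm ((q + -1, r), i)
  rw [spacedBlocks_symm_apply, spacedBlocks_symm_apply]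
  ring

lemma addRight_trans_spacedBlocks (n : ℕ) [NeZero n] (j m : ℤ) :
    (Equiv.addRight m).trans (spacedBlocks n j) = spacedBlocks n (j + m) := by
  ext s : 1
  simp only [spacedBlocks, Equiv.trans_apply, Equiv.coe_addRight]
  rw [add_assoc, add_comm m j]

/-- The block `{0, n, ..., (n - 1) * n}`. -/
def multiples (n : ℕ) : Finset ℤ := Finset.univ.image fun i : Fin n => (i * n : ℤ)

lemma card_multiples (n : ℕ) [NeZero n] : (multiples n).card = n := by
  rw [multiples, Finset.card_image_of_injective, Finset.card_univ, Fintype.card_fin]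
  intro i i' h
  have : (n : ℤ) ≠ 0 := by exact_mod_cast NeZero.ne n
  have := mul_right_cancel₀ this h
  exact Fin.ext (by exact_mod_cast this)

/-- Two consecutive points of the block differ by `m`, a positive multiple of `n`, so `n ≤ m`.
Comparing diameters, `(m - 1) * m ≤ (n - 1) * n`, so `m ≤ n`. -/
lemma eq_of_block_subset_multiples {n m : ℕ} [NeZero m] (hm : 2 ≤ m) (j : ℤ)
    (w : ℤ × Fin m) (h : ∀ k, (spacedBlocks m j).symm (w, k) ∈ multiples n) : m = n := by
  obtain ⟨q, r⟩ := w
  simp only [spacedBlocks_symm_apply, multiples, Finset.mem_image, Finset.mem_univ,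
    true_and] at h
  obtain ⟨a, ha⟩ := h ⟨0, by omega⟩
  obtain ⟨b, hb⟩ := h ⟨1, by omega⟩
  obtain ⟨c, hc⟩ := h ⟨m - 1, by omega⟩
  have hc2 : ((m - 1 : ℕ) : ℤ) = m - 1 := by omega
  simp only [hc2, Nat.cast_zero, Nat.cast_one] at ha hb hc
  have h1 : ((b : ℤ) - a) * n = m := by linear_combination hb - ha
  have h2 : ((c : ℤ) - a) * n = (m - 1) * m := by linear_combination hc - ha
  have hcn : (c : ℤ) + 1 ≤ n := by have := c.2; omega
  have ha0 : (0 : ℤ) ≤ a := by positivity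
  have hm' : (2 : ℤ) ≤ m := by exact_mod_cast hm
  have hn0 : (0 : ℤ) ≤ n := by positivity
  have hba : 1 ≤ (b : ℤ) - a := by
    by_contra hlt
    have : (b : ℤ) - a ≤ 0 := by omega
    nlinarith
  have hnm : (n : ℤ) ≤ m := by nlinarith
  have hmn : (m : ℤ) ≤ n := by
    by_contra hlt
    nlinarith [mul_le_mul_of_nonneg_right (show (c : ℤ) - a ≤ n - 1 by omega) hn0]
  omega

lemma integral_testFactor_multiples_zero (n : ℕ) [NeZero n] (ε : ℝ) :
    ∫ x, ∏ s ∈ multiples n, testFactor ε (x s) ∂blockLaw (spacedBlocks n 0) =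
      ((1 - 2 * ε) / 2) ^ n - 1 / 2 * (1 / 2) ^ n := by
  have h := integral_blockLaw_block (spacedBlocks n 0) (0, 0) (testFactor ε)
  have hB : Finset.univ.image (fun k => (spacedBlocks n 0).symm ((0, 0), k)) = multiples n := by
    simp [spacedBlocks_symm_apply, multiples]
  rw [hB] at h
  rw [h, Fintype.card_fin]
  simp only [testFactor, if_true, Bool.false_eq_true, if_false]
  ring

lemma integral_testFactor_multiples_le {n m : ℕ} [NeZero n] [NeZero m] (hm : 2 ≤ m) (j : ℤ)
    (ε : ℝ) :
    ∫ x, ∏ s ∈ multiples n, testFactor ε (x s) ∂blockLaw (spacedBlocks m j) ≤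
      ((1 - 2 * ε) / 2) ^ n := by
  have e1 : (testFactor ε true + testFactor ε false) / 2 = (1 - 2 * ε) / 2 := by
    simp [testFactor]; ring
  by_cases h : ∀ w, ∃ k, (spacedBlocks m j).symm (w, k) ∉ multiples n
  · rw [integral_blockLaw_of_forall_notMem _ _ _ h, card_multiples, e1]
  · push Not at h
    obtain ⟨w, hw⟩ := h
    obtain rfl := eq_of_block_subset_multiples hm j w hw
    have hB : Finset.univ.image (fun k => (spacedBlocks m j).symm (w, k)) = multiples m := by
      refine Finset.eq_of_subset_of_card_le (Finset.image_subset_iff.2 fun k _ => hw k) ?_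
      rw [card_multiples, Finset.card_image_of_injective _ fun k k' h => by simpa using h,
        Finset.card_univ, Fintype.card_fin]
    have h := integral_blockLaw_block (spacedBlocks m j) w (testFactor ε)
    rw [hB] at h
    rw [h, Fintype.card_fin, e1]
    have e2 : (testFactor ε true - testFactor ε false) / 2 = 1 / 2 := by
      simp [testFactor]
    rw [e2]
    have : (0 : ℝ) ≤ (1 / 2) ^ m := by positivity
    linarith

/-! ### The translation-invariant mixture -/

/-- The pairs of a scale `k`, with blocks of size `2 ^ (k + 1)`, and an offset. -/
abbrev ScaleOffset : Type := Σ k : ℕ, Fin ((2 ^ (k + 1)) ^ 2)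

/-- The weight of a scale and offset in `blockMixture`. -/
noncomputable def scaleWeight (i : ScaleOffset) : ℝ≥0∞ := ((2 ^ (i.1 + 1)) ^ 3)⁻¹

/-- A mixture of block laws over all scales and, for each scale, uniform over all offsets. -/
noncomputable def blockMixture : Measure (Config ℤ) :=
  Measure.sum fun i : ScaleOffset =>
    scaleWeight i • blockLaw (spacedBlocks (2 ^ (i.1 + 1)) (i.2 : ℕ))

lemma tsum_scaleWeight : ∑' i, scaleWeight i = 1 := by
  rw [ENNReal.tsum_sigma fun k j => scaleWeight ⟨k, j⟩]
  simp only [scaleWeight, tsum_fintype, Finset.sum_const, Finset.card_univ, Fintype.card_fin,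
    nsmul_eq_mul]
  -- With `n = 2 ^ (k + 1)`, the `n ^ 2` offsets of weight `n⁻³` give the scale total weight `1 /
  -- n`.
  have (k : ℕ) : (((2 ^ (k + 1)) ^ 2 : ℕ) : ℝ≥0∞) * ((2 ^ (k + 1)) ^ 3)⁻¹ = 2⁻¹ ^ (k + 1) := by
    have h0 : (2 ^ (k + 1) : ℝ≥0∞) ≠ 0 := by positivity
    have h1 : (2 ^ (k + 1) : ℝ≥0∞) ≠ ⊤ := by finiteness
    push_cast
    rw [ENNReal.inv_pow.symm]
    generalize (2 ^ (k + 1) : ℝ≥0∞) = x at *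
    rw [pow_succ x 2, ENNReal.mul_inv (by simp [h1]) (by simp [h0]), ← mul_assoc,
      ENNReal.mul_inv_cancel (by simp [h0]) (by finiteness), one_mul]
  simp_rw [this, pow_succ, ENNReal.tsum_mul_right, ENNReal.tsum_geometric]
  rw [ENNReal.one_sub_inv_two, inv_inv, ENNReal.mul_inv_cancel (by simp) (by simp)]

instance : IsProbabilityMeasure blockMixture where
  measure_univ := by
    rw [blockMixture, Measure.sum_apply _ MeasurableSet.univ]
    simp [tsum_scaleWeight]

lemma flipBounded_blockMixture : FlipBounded blockMixture := by
  intro s A hA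
  rw [blockMixture, Measure.sum_apply _ hA, Measure.sum_apply _ (measurable_flipAt s hA),
    ← ENNReal.tsum_mul_left]
  refine ENNReal.tsum_le_tsum fun i => ?_
  rw [Measure.smul_apply, Measure.smul_apply, smul_eq_mul, smul_eq_mul, mul_left_comm]
  gcongr
  exact flipBounded_blockLaw _ s A hA

lemma blockLaw_spacedBlocks_periodic (n : ℕ) [NeZero n] :
    Function.Periodic (fun j : ℕ => blockLaw (spacedBlocks n j)) (n ^ 2) := by
  intro j
  dsimp only
  push_cast
  rw [spacedBlocks_add_sq, blockLaw_trans_prodCongr]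

/-- Addition in `Fin (n ^ 2)` wraps around, which is harmless by the periodicity in the offset. -/
lemma map_succ_blockLaw_spacedBlocks (n : ℕ) [NeZero n] (j : Fin (n ^ 2)) :
    (blockLaw (spacedBlocks n (j : ℕ))).map (fun (x : Config ℤ) (k : ℤ) => x (k + 1)) =
      blockLaw (spacedBlocks n ((j + 1 : Fin (n ^ 2)) : ℕ)) := by
  have h1 := map_blockLaw_comp (spacedBlocks n (j : ℕ)) (Equiv.addRight (1 : ℤ))
  rw [addRight_trans_spacedBlocks] at h1
  have h2 := (blockLaw_spacedBlocks_periodic n).map_mod_nat (j + 1)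
  have h3 : ((j + 1 : Fin (n ^ 2)) : ℕ) = (j + 1 : ℕ) % n ^ 2 := by
    rw [Fin.val_add]; simp
  rw [h3]
  refine h1.trans ?_
  simpa using h2.symm

/-- The shift of all offsets by one. -/
def shiftOffset : Equiv.Perm ScaleOffset :=
  Equiv.sigmaCongrRight fun _ => Equiv.addRight 1

lemma map_succ_blockMixture :
    blockMixture.map (fun (x : Config ℤ) (k : ℤ) => x (k + 1)) = blockMixture := by
  have hπ (i : ScaleOffset) :
      (scaleWeight i • blockLaw (spacedBlocks (2 ^ (i.1 + 1)) (i.2 : ℕ))).map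
        (fun (x : Config ℤ) (k : ℤ) => x (k + 1)) =
      scaleWeight (shiftOffset i) •
        blockLaw (spacedBlocks (2 ^ ((shiftOffset i).1 + 1)) ((shiftOffset i).2 : ℕ)) := by
    rw [Measure.map_smul, map_succ_blockLaw_spacedBlocks]
    rfl
  have hm := measurable_comp_config (Equiv.addRight (1 : ℤ))
  simp only [Equiv.coe_addRight] at hm
  rw [blockMixture, Measure.map_sum hm.aemeasurable]
  simp_rw [hπ]
  ext A hA
  rw [Measure.sum_apply _ hA, Measure.sum_apply _ hA]
  exact shiftOffset.tsum_eq fun i : ScaleOffset =>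
    (scaleWeight i • blockLaw (spacedBlocks (2 ^ (i.1 + 1)) (i.2 : ℕ))) A

lemma isTranslationInvariant_of_map_succ {μ : Measure (Config ℤ)}
    (h : μ.map (fun (x : Config ℤ) (k : ℤ) => x (k + 1)) = μ) : IsTranslationInvariant μ := by
  have hm (n : ℤ) := measurable_comp_config (Equiv.addRight n)
  simp only [Equiv.coe_addRight] at hm
  have hadd (m n : ℤ) : (μ.map fun (x : Config ℤ) (k : ℤ) => x (k + m)).map
      (fun (x : Config ℤ) (k : ℤ) => x (k + n)) =
        μ.map fun (x : Config ℤ) (k : ℤ) => x (k + (n + m)) := by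
    rw [Measure.map_map (hm n) (hm m)]
    simp only [Function.comp_def, add_assoc]
  have h0 : μ.map (fun (x : Config ℤ) (k : ℤ) => x (k + 0)) = μ := by
    simp only [add_zero]
    exact Measure.map_id
  intro n
  induction n with
  | zero => exact h0
  | succ n ih => rw [← hadd, h, ih]
  | pred n ih =>
    have := hadd 1 (-(n : ℤ) - 1)
    rw [h, sub_add_cancel, ih] at this
    exact this

lemma hasNegativeTests_blockMixture : HasNegativeTests blockMixture := by
  intro ε h0 h1
  obtain ⟨k, hk⟩ :
      ∃ k : ℕ, ((2 ^ (k + 1) : ℕ) : ℝ) ^ 3 * (1 - 2 * ε) ^ (2 ^ (k + 1)) < 1 / 2 := by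
    have hr : |1 - 2 * ε| < 1 := by rw [abs_lt]; constructor <;> linarith
    have ht := (tendsto_pow_const_mul_const_pow_of_abs_lt_one 3 hr).comp
      ((tendsto_pow_atTop_atTop_of_one_lt one_lt_two).comp (Filter.tendsto_add_atTop_nat 1))
    exact (ht.eventually (gt_mem_nhds (by norm_num : (0 : ℝ) < 1 / 2))).exists
  set n := 2 ^ (k + 1) with hn
  refine ⟨multiples n, ?_⟩
  have hint := integrable_prod_testFactor h0.le h1.le (multiples n) blockMixture
  have hsum := hasSum_integral_measure hint
  have hw : HasSum (fun i => (scaleWeight i).toReal) 1 := by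
    have := ENNReal.hasSum_toReal (f := scaleWeight) (by simp [tsum_scaleWeight])
    rwa [← ENNReal.tsum_toReal_eq, tsum_scaleWeight, ENNReal.toReal_one] at this
    intro i
    simp [scaleWeight]
  -- At this scale and offset `multiples n` is a full block, so the bound includes its tilt term;
  -- for all other components the fair value suffices.
  let i₀ : ScaleOffset := ⟨k, 0⟩
  have hbound := (hw.mul_right (((1 - 2 * ε) / 2) ^ n)).sub
    (hasSum_ite_eq i₀ ((scaleWeight i₀).toReal * (1 / 2 * (1 / 2) ^ n)))
  refine lt_of_le_of_lt (hasSum_le (fun i => ?_) hsum hbound) ?_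
  · rw [integral_smul_measure, smul_eq_mul]
    split_ifs with hi
    · subst hi
      rw [← mul_sub]
      gcongr
      have := integral_testFactor_multiples_zero n ε
      exact (by simpa [i₀] using this.le)
    · rw [sub_zero]
      gcongr
      exact integral_testFactor_multiples_le (Nat.le_self_pow (by omega) 2) _ ε
  · have hw0 : (scaleWeight i₀).toReal = ((n : ℝ) ^ 3)⁻¹ := by
      simp [scaleWeight, i₀, hn]
    have hn0 : (0 : ℝ) < n := by rw [hn]; positivity
    rw [hw0, div_pow, one_div_pow]
    have : (1 : ℝ) * ((1 - 2 * ε) ^ n / 2 ^ n) - ((n : ℝ) ^ 3)⁻¹ * (1 / 2 * (1 / 2 ^ n)) =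
        ((n : ℝ) ^ 3 * (1 - 2 * ε) ^ n - 1 / 2) / (n ^ 3 * 2 ^ n) := by
      field_simp
    rw [this]
    exact div_neg_of_neg_of_pos (by linarith) (by positivity)

end SpinMeasure

theorem theorem3p2 :
    (∀ (S : Type*) [Countable S] [Infinite S],
      ∃ μ : MeasureTheory.Measure (SpinMeasure.Config S),
        MeasureTheory.IsProbabilityMeasure μ ∧
        SpinMeasure.IsUniformlyInsertionTolerant μ ∧
        ¬ SpinMeasure.IsUniformlyUpwardsExtractable μ) ∧
    (∃ μ : MeasureTheory.Measure (SpinMeasure.Config ℤ),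
        MeasureTheory.IsProbabilityMeasure μ ∧
        SpinMeasure.IsTranslationInvariant μ ∧
        SpinMeasure.IsUniformlyInsertionTolerant μ ∧
        ¬ SpinMeasure.IsUniformlyUpwardsExtractable μ) := by
  refine ⟨fun S _ _ => ?_, SpinMeasure.blockMixture, inferInstance,
    SpinMeasure.isTranslationInvariant_of_map_succ SpinMeasure.map_succ_blockMixture,
    SpinMeasure.flipBounded_blockMixture.isUniformlyInsertionTolerant,
    SpinMeasure.hasNegativeTests_blockMixture.not_isUniformlyUpwardsExtractable⟩
  classical
  obtain ⟨e⟩ := nonempty_equiv_of_countable (α := S) (β := ℤ)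
  have hP := Measure.isProbabilityMeasure_map (μ := SpinMeasure.blockMixture)
    (SpinMeasure.measurable_comp_config e).aemeasurable
  exact ⟨_, hP, (SpinMeasure.flipBounded_blockMixture.map_equiv e).isUniformlyInsertionTolerant,
    (SpinMeasure.hasNegativeTests_blockMixture.map_equiv e).not_isUniformlyUpwardsExtractable⟩
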